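/- Let $\mathbb K=\mathbb R$ or $\mathbb C$, and let $\mathcal A$ be an almost disjoint family: a (possibly empty or countable) family of infinite subsets of $\mathbb N$ such that $A\cap A'$ is finite for all distinct $A,A'\in\mathcal A$. Let $K_{\mathcal A}$ be the topological space consisting of distinct points $x_n$ ($n\in\mathbb N$) and $y_A$ ($A\in\mathcal A$), where every $x_n$ is isolated and the sets $\{x_n:n\in A\setminus F\}\cup\{y_A\}$, with $F\subseteq\mathbb N$ finite, form a neighbourhood basis at $y_A$. Let $X=C_0(K_{\mathcal A})$ be the Banach space of continuous functions $K_{\mathcal A}\to\mathbb K$ vanishing at infinity, with the supremum norm; let $\mathscr B(X)$ be the Banach algebra of bounded linear operators on $X$, and let $\mathscr X(X)$ be its ideal of operators with separable range. An operator $T\in\mathscr B(X)$ is compressible if, for some integer $n\ge1$, there is a sequence $(Q_j)$ of bounded linear projections on $X^n$ such that $Q_jQ_k=0$ whenever $j\ne k$ and, for every $j$, $T=SQ_jR$ for some bounded linear operators $R\colon X\to X^n$ and $S\colon X^n\to X$. A homomorphism into a Banach algebra is a $\mathbb K$-linear multiplicative map; neither the target algebra nor the map need be unital. Then: 1. Every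 $T\in\mathscr X(X)$ is compressible. 2. If $(T_j)$ is a sequence in $\mathscr X(X)$ with $\|T_j\|\to0$, then there are $S\in\mathscr X(X)$ and a sequence $(R_j)$ in $\mathscr X(X)$ such that $T_j=SR_j$ for every $j$ and $\|R_j\|\to0$. 3. Every homomorphism from $\mathscr X(X)$ into a Banach algebra over $\mathbb K$ is continuous. 4. If $\mathscr X(X)$ has finite codimension in $\mathscr B(X)$, then every homomorphism from $\mathscr B(X)$ into a Banach algebra over $\mathbb K$ is continuous. 5. The hypothesis of 4 holds whenever every $T\in\mathscr B(X)$ has the form $T=\lambda\,\mathrm{Id}+S$ with $\lambda\in\mathbb K$ and $S\in\mathscr B(X)$ factoring through $c_0$ (that is, $S=VU$ for some bounded linear operators $U\colon X\to c_0$ and $V\colon c_0\to X$). -/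

import Mathlib

open Filter Topology
open scoped ZeroAtInfty

/-- A family of infinite subsets of `ℕ`, any two distinct members of which have finite
intersection. -/
def IsAlmostDisjointFamily (𝒜 : Set (Set ℕ)) : Prop :=
  (∀ A ∈ 𝒜, A.Infinite) ∧ ∀ A ∈ 𝒜, ∀ B ∈ 𝒜, A ≠ B → (A ∩ B).Finite

/-- The points of the space `K_𝒜`: distinct points `x n` for `n : ℕ` and `y A` for `A ∈ 𝒜`. -/
inductive PsiSpace (𝒜 : Set (Set ℕ)) : Type
  | x (n : ℕ) : PsiSpace 𝒜
  | y (A : 𝒜) : PsiSpace 𝒜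

namespace PsiSpace

/-- The set `U(A, F) = {x n : n ∈ A \ F} ∪ {y A}`. -/
def basicNhd {𝒜 : Set (Set ℕ)} (A : 𝒜) (F : Set ℕ) : Set (PsiSpace 𝒜) :=
  {p | (∃ n ∈ (A : Set ℕ) \ F, p = x n) ∨ p = y A}

/-- A set is open when, with each point `y A`, it contains `U(A, F)` for some finite `F`; there
is no condition at the points `x n`. -/
instance (𝒜 : Set (Set ℕ)) : TopologicalSpace (PsiSpace 𝒜) where
  IsOpen U := ∀ A : 𝒜, y A ∈ U → ∃ F : Set ℕ, F.Finite ∧ basicNhd A F ⊆ U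
  isOpen_univ := fun _ _ => ⟨∅, Set.finite_empty, Set.subset_univ _⟩
  isOpen_inter := by
    rintro U V hU hV A ⟨hAU, hAV⟩
    obtain ⟨F, hF, hFU⟩ := hU A hAU
    obtain ⟨G, hG, hGV⟩ := hV A hAV
    refine ⟨F ∪ G, hF.union hG, ?_⟩
    rintro p (⟨n, ⟨hnA, hn⟩, rfl⟩ | rfl)
    · exact ⟨hFU (Or.inl ⟨n, ⟨hnA, fun h => hn (Or.inl h)⟩, rfl⟩),
        hGV (Or.inl ⟨n, ⟨hnA, fun h => hn (Or.inr h)⟩, rfl⟩)⟩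
    · exact ⟨hAU, hAV⟩
  isOpen_sUnion := by
    rintro s hs A ⟨U, hU, hAU⟩
    obtain ⟨F, hF, hFU⟩ := hs U hU A hAU
    exact ⟨F, hF, hFU.trans (Set.subset_sUnion_of_mem hU)⟩

theorem isOpen_singleton_x {𝒜 : Set (Set ℕ)} (n : ℕ) : IsOpen ({x n} : Set (PsiSpace 𝒜)) := by
  intro A hA
  cases hA

/-- The sets `U(A, F)` with `F` finite form a neighbourhood basis at `y A`. -/
theorem nhds_y_hasBasis {𝒜 : Set (Set ℕ)} (A : 𝒜) :
    (𝓝 (y A)).HasBasis (fun F : Set ℕ => F.Finite) (basicNhd A) := by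
  refine ⟨fun t => ?_⟩
  rw [mem_nhds_iff]
  constructor
  · rintro ⟨U, hUt, hU, hA⟩
    obtain ⟨F, hF, hFU⟩ := hU A hA
    exact ⟨F, hF, hFU.trans hUt⟩
  · rintro ⟨F, hF, hFt⟩
    refine ⟨basicNhd A F, hFt, ?_, Or.inr rfl⟩
    rintro B (⟨n, -, h⟩ | h)
    · cases h
    · cases h
      exact ⟨F, hF, subset_rfl⟩

end PsiSpace

section Operators

variable (𝕜 : Type*) [RCLike 𝕜] (E : Type*) [NormedAddCommGroup E] [NormedSpace 𝕜 E]

/-- The bounded operators on `E` with separable range, as a (not necessarily unital) subalgebra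
of the algebra of bounded operators. -/
def separableRangeIdeal : NonUnitalSubalgebra 𝕜 (E →L[𝕜] E) where
  carrier := {T | TopologicalSpace.IsSeparable (Set.range T)}
  zero_mem' := by
    refine (Set.countable_singleton (0 : E)).isSeparable.mono ?_
    rintro _ ⟨v, rfl⟩
    rfl
  add_mem' := by
    intro S T hS hT
    refine ((hS.prod hT).image (continuous_fst.add continuous_snd)).mono ?_
    rintro _ ⟨v, rfl⟩
    exact ⟨(S v, T v), ⟨⟨v, rfl⟩, ⟨v, rfl⟩⟩, rfl⟩
  mul_mem' := by
    intro S T hS _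
    refine hS.mono ?_
    rintro _ ⟨v, rfl⟩
    exact ⟨T v, rfl⟩
  smul_mem' := by
    intro c T hT
    refine (hT.image (continuous_const_smul c)).mono ?_
    rintro _ ⟨v, rfl⟩
    exact ⟨T v, ⟨v, rfl⟩, rfl⟩

variable {𝕜 E}

/-- The operators with separable range form a two-sided ideal. -/
theorem mul_mul_mem_separableRangeIdeal (R S T : E →L[𝕜] E)
    (hS : S ∈ separableRangeIdeal 𝕜 E) : R * S * T ∈ separableRangeIdeal 𝕜 E := by
  change TopologicalSpace.IsSeparable (Set.range S) at hS
  refine TopologicalSpace.IsSeparable.mono (hS.image R.continuous) ?_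
  rintro _ ⟨v, rfl⟩
  exact ⟨S (T v), ⟨T v, rfl⟩, rfl⟩

/-- `T` is compressible: for some `n ≥ 1` there is a sequence of pairwise orthogonal bounded
projections on the direct sum of `n` copies of `E`, through each of which `T` factors. -/
def IsCompressible (T : E →L[𝕜] E) : Prop :=
  ∃ n : ℕ, 1 ≤ n ∧ ∃ Q : ℕ → ((Fin n → E) →L[𝕜] (Fin n → E)),
    (∀ j, Q j ∘L Q j = Q j) ∧
    (∀ j k, j ≠ k → Q j ∘L Q k = 0) ∧
    ∀ j, ∃ (R : E →L[𝕜] (Fin n → E)) (S : (Fin n → E) →L[𝕜] E), T = S ∘L Q j ∘L R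

/-- `T = V U` for bounded operators `U : E → c₀` and `V : c₀ → E`. Here `c₀` is the space of
functions on the discrete space `ℕ` that vanish at infinity. -/
def FactorsThroughC0 (T : E →L[𝕜] E) : Prop :=
  ∃ (U : E →L[𝕜] C₀(ℕ, 𝕜)) (V : C₀(ℕ, 𝕜) →L[𝕜] E), T = V ∘L U

end Operators

/-! Everything follows from two properties of `X = C₀(K_𝒜)`: it has a complemented copy of `c₀`
(`hasComplementedC0`), and each separable subset lies in a subspace whose inclusion factors through
`c₀` (`separablyThroughC0`).

For the second, a function in `X` is nonzero at only countably many `y A`, so a separable set lives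
over a countable subfamily. Almost disjointness makes this subfamily disjoint after finite changes
of its members. A function is then encoded by its values at the `y A` and the differences `f (x n) -
f (y A)`, with `A` the set to which `n` is assigned. These coordinates lie in `c₀`, and the encoding
has a bounded left inverse.

So operators with separable range factor through `c₀`, with a common left factor for a sequence of
them. Splitting `ℕ` into infinitely many infinite rows gives orthogonal projections of `c₀` onto
copies of itself; carried to `X`, these give compressibility.

For a homomorphism `θ`, a gliding hump bounds `a ↦ θ (q j * a)` for one such projection `q j`. A
null sequence factors as `T n = S * R n` with `R n` null, and `S = s * q j * r`, so `θ (T n) = θ s *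
θ (q j * r * R n)` tends to zero. -/

/-! ### Automatic continuity in Banach algebras -/

section BanachAlgebra

/-- For a homomorphism `θ` from a Banach algebra and a sequence of orthogonal idempotents `q j`,
the map `a ↦ θ (q j * a)` is bounded for at least one `j`. -/
theorem exists_bound_map_idempotent_mul {𝕜 A C : Type*} [RCLike 𝕜]
    [NonUnitalNormedRing A] [NormedSpace 𝕜 A] [IsScalarTower 𝕜 A A] [SMulCommClass 𝕜 A A]
    [CompleteSpace A]
    [NonUnitalNormedRing C] [NormedSpace 𝕜 C]
    (θ : A →ₙₐ[𝕜] C) (q : ℕ → A) (hq : ∀ j, q j * q j = q j)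
    (hqq : ∀ j k, j ≠ k → q j * q k = 0) :
    ∃ j, ∃ K : ℝ, 0 ≤ K ∧ ∀ a, ‖θ (q j * a)‖ ≤ K * ‖a‖ := by
  by_contra! H
  -- The factor `2 ^ j * (1 + ‖q j‖)` pays for making the series of the `b j` converge; the factor
  -- `j * (1 + ‖θ (q j)‖)` survives the rescaling and gives the contradiction.
  choose a ha using fun j : ℕ =>
    H j (2 ^ j * (1 + ‖q j‖) * (j * (1 + ‖θ (q j)‖))) (by positivity)
  have ha0 : ∀ j, 0 < ‖a j‖ := by
    intro j
    rw [norm_pos_iff]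
    intro h0
    have := ha j
    simp [h0] at this
  set c : ℕ → ℝ := fun j => (2 ^ j * (1 + ‖q j‖) * ‖a j‖)⁻¹ with hc
  have hden : ∀ j, 0 < 2 ^ j * (1 + ‖q j‖) * ‖a j‖ := fun j =>
    mul_pos (by positivity) (ha0 j)
  have hcpos : ∀ j, 0 < c j := fun j => inv_pos.2 (hden j)
  set b : ℕ → A := fun j => (c j : 𝕜) • (q j * a j) with hb
  have hbn : ∀ j, ‖b j‖ ≤ (1 / 2 : ℝ) ^ j := by
    intro j
    have h1 : ‖b j‖ ≤ c j * (‖q j‖ * ‖a j‖) := by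
      rw [hb]
      simp only [norm_smul, RCLike.norm_ofReal, abs_of_pos (hcpos j)]
      exact mul_le_mul_of_nonneg_left (norm_mul_le _ _) (hcpos j).le
    refine h1.trans ?_
    rw [hc]
    simp only
    rw [inv_mul_le_iff₀ (hden j), one_div, inv_pow]
    have : (2 : ℝ) ^ j * (1 + ‖q j‖) * ‖a j‖ * (2 ^ j)⁻¹ = (1 + ‖q j‖) * ‖a j‖ := by
      field_simp
    rw [this]
    exact mul_le_mul_of_nonneg_right (by linarith) (ha0 j).le
  have hbs : Summable b := Summable.of_norm_bounded summable_geometric_two hbn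
  -- Orthogonality recovers every `b j` from the single sum, so `‖θ (b j)‖` is at most `‖θ (q j)‖`
  -- times a constant independent of `j`.
  have hmul : ∀ j, q j * (∑' k, b k) = b j := by
    intro j
    rw [← hbs.tsum_mul_left, tsum_eq_single j]
    · simp only [hb, mul_smul_comm, ← mul_assoc, hq]
    · intro k hk
      simp only [hb, mul_smul_comm, ← mul_assoc, hqq j k hk.symm, zero_mul, smul_zero]
  obtain ⟨j, hj⟩ := exists_nat_gt ‖θ (∑' k, b k)‖
  have h1 : ‖θ (b j)‖ ≤ ‖θ (q j)‖ * ‖θ (∑' k, b k)‖ := by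
    conv_lhs => rw [← hmul j, map_mul]
    exact norm_mul_le _ _
  have h2 : (j : ℝ) * (1 + ‖θ (q j)‖) < ‖θ (b j)‖ := by
    have : ‖θ (b j)‖ = c j * ‖θ (q j * a j)‖ := by
      simp only [hb, map_smul, norm_smul, RCLike.norm_ofReal, abs_of_pos (hcpos j)]
    rw [this, hc, lt_inv_mul_iff₀ (hden j)]
    calc _ = 2 ^ j * (1 + ‖q j‖) * (j * (1 + ‖θ (q j)‖)) * ‖a j‖ := by ring
      _ < _ := ha j
  have h3 : ‖θ (q j)‖ * ‖θ (∑' k, b k)‖ ≤ j * (1 + ‖θ (q j)‖) := by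
    have := norm_nonneg (θ (q j))
    have := norm_nonneg (θ (∑' k, b k))
    nlinarith
  linarith

/-- A linear map that is continuous on a closed subspace of finite codimension is continuous. -/
theorem LinearMap.continuous_of_continuous_restrict {𝕜 E F : Type*} [RCLike 𝕜]
    [NormedAddCommGroup E] [NormedSpace 𝕜 E] [NormedAddCommGroup F] [NormedSpace 𝕜 F]
    (p : Submodule 𝕜 E) (hp : IsClosed (p : Set E)) [FiniteDimensional 𝕜 (E ⧸ p)]
    (f : E →ₗ[𝕜] F) (hf : Continuous fun x : p => f x) : Continuous f := by
  obtain ⟨P, hP⟩ := Submodule.ClosedComplemented.of_finiteDimensional_quotient (𝕜 := 𝕜) hp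
  -- With `P` a bounded projection onto `p`, the map `f - f ∘ P` kills `p`, so it factors through
  -- the finite-dimensional quotient, which is Hausdorff because `p` is closed.
  have hker : p ≤ LinearMap.ker (f - f ∘ₗ p.subtype ∘ₗ P.toLinearMap) := by
    intro x hx
    have := hP ⟨x, hx⟩
    simp only [LinearMap.mem_ker, LinearMap.sub_apply, LinearMap.comp_apply]
    simp [this]
  have : IsClosed (p : Set E) := hp
  have hg : Continuous (p.liftQ _ hker) := LinearMap.continuous_of_finiteDimensional _
  have hq : Continuous (p.mkQ) := continuous_quot_mk
  have h1 : Continuous fun x => p.liftQ _ hker (p.mkQ x) := hg.comp hq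
  have h2 : Continuous fun x => f (P x : E) := hf.comp P.continuous
  convert h1.add h2 using 1
  ext x
  simp

end BanachAlgebra

/-! ### The ideal of operators with separable range -/

section SeparableRange

variable {𝕜 : Type*} [RCLike 𝕜] {E : Type*} [NormedAddCommGroup E] [NormedSpace 𝕜 E]

/-- The range of a limit of operators lies in the closure of the union of their ranges, and a
countable union of separable sets is separable. -/
theorem isClosed_separableRangeIdeal :
    IsClosed (separableRangeIdeal 𝕜 E : Set (E →L[𝕜] E)) := by
  refine IsSeqClosed.isClosed fun T S hT hTS => ?_
  refine (TopologicalSpace.IsSeparable.iUnion hT).closure.mono ?_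
  rintro _ ⟨v, rfl⟩
  have h : Tendsto (fun n => T n v) atTop (𝓝 (S v)) :=
    ((ContinuousLinearMap.apply 𝕜 E v).continuous.tendsto S).comp hTS
  exact mem_closure_of_tendsto h
    (Eventually.of_forall fun n => Set.mem_iUnion.2 ⟨n, Set.mem_range_self v⟩)

noncomputable instance : NormedSpace 𝕜 (separableRangeIdeal 𝕜 E) where
  norm_smul_le c T := norm_smul_le c (T : E →L[𝕜] E)

instance [CompleteSpace E] : CompleteSpace (separableRangeIdeal 𝕜 E) :=
  isClosed_separableRangeIdeal.completeSpace_coe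

theorem comp_mem_separableRangeIdeal {G : Type*} [NormedAddCommGroup G] [NormedSpace 𝕜 G]
    [TopologicalSpace.SeparableSpace G] (V : G →L[𝕜] E) (U : E →L[𝕜] G) :
    V ∘L U ∈ separableRangeIdeal 𝕜 E := by
  refine (TopologicalSpace.isSeparable_range V.continuous).mono ?_
  rintro _ ⟨v, rfl⟩
  exact ⟨U v, rfl⟩

end SeparableRange

/-! ### `c₀` over discrete index sets -/

section VanishingFunctions

variable {𝕜 : Type*} [RCLike 𝕜]

theorem ZeroAtInftyContinuousMap.norm_apply_le {X : Type*} [TopologicalSpace X]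
    (f : C₀(X, 𝕜)) (x : X) : ‖f x‖ ≤ ‖f‖ := by
  rw [← ZeroAtInftyContinuousMap.norm_toBCF_eq_norm]
  exact f.toBCF.norm_coe_le_norm x

theorem ZeroAtInftyContinuousMap.norm_le_of_forall {X : Type*} [TopologicalSpace X]
    {f : C₀(X, 𝕜)} {c : ℝ} (hc : 0 ≤ c) (h : ∀ x, ‖f x‖ ≤ c) : ‖f‖ ≤ c := by
  rw [← ZeroAtInftyContinuousMap.norm_toBCF_eq_norm, BoundedContinuousFunction.norm_le hc]
  exact h

theorem tendsto_cofinite_zero_iff {D : Type*} {f : D → 𝕜} :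
    Tendsto f cofinite (𝓝 0) ↔ ∀ ε > 0, {d | ε ≤ ‖f d‖}.Finite := by
  simp only [Metric.tendsto_nhds, eventually_cofinite, dist_zero_right, not_lt]

theorem Function.Injective.tendsto_extend_zero {D D' : Type*} {i : D → D'} (hi : Function.Injective i)
    {f : D → 𝕜} (hf : Tendsto f cofinite (𝓝 0)) :
    Tendsto (Function.extend i f 0) cofinite (𝓝 0) := by
  rw [tendsto_cofinite_zero_iff] at hf ⊢
  intro ε hε
  refine ((hf ε hε).image i).subset ?_
  intro d hd
  by_cases h : ∃ k, i k = d
  · obtain ⟨k, rfl⟩ := h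
    rw [Set.mem_ofPred_eq, hi.extend_apply] at hd
    exact ⟨k, hd, rfl⟩
  · rw [Set.mem_ofPred_eq, Function.extend_apply' _ _ _ h] at hd
    simp only [Pi.zero_apply, norm_zero] at hd
    linarith

section Discrete

variable {D D' : Type*} [TopologicalSpace D] [DiscreteTopology D]
  [TopologicalSpace D'] [DiscreteTopology D']

/-- A function on a discrete space tending to zero along the cofinite filter, as an element
of `C₀`. -/
def ZeroAtInftyContinuousMap.ofCofinite (f : D → 𝕜) (hf : Tendsto f cofinite (𝓝 0)) :
    C₀(D, 𝕜) :=
  ⟨⟨f, continuous_of_discreteTopology⟩, by rwa [cocompact_eq_cofinite]⟩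

@[simp]
theorem ZeroAtInftyContinuousMap.ofCofinite_apply (f : D → 𝕜) (hf : Tendsto f cofinite (𝓝 0))
    (d : D) : ofCofinite f hf d = f d := rfl

theorem ZeroAtInftyContinuousMap.tendsto_cofinite (f : C₀(D, 𝕜)) :
    Tendsto f cofinite (𝓝 0) := by
  rw [← cocompact_eq_cofinite]
  exact f.zero_at_infty'

/-- Extension by zero along an injection of discrete spaces. -/
noncomputable def extendC0 (i : D → D') (hi : Function.Injective i) :
    C₀(D, 𝕜) →L[𝕜] C₀(D', 𝕜) :=
  LinearMap.mkContinuous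
    { toFun := fun f => .ofCofinite (Function.extend i f 0)
        (hi.tendsto_extend_zero f.tendsto_cofinite)
      map_add' := fun f g => by
        ext d
        by_cases h : ∃ k, i k = d
        · obtain ⟨k, rfl⟩ := h
          simp [hi.extend_apply]
        · simp [Function.extend_apply' _ _ _ h]
      map_smul' := fun c f => by
        ext d
        by_cases h : ∃ k, i k = d
        · obtain ⟨k, rfl⟩ := h
          simp [hi.extend_apply]
        · simp [Function.extend_apply' _ _ _ h] } 1 fun f => by
    refine ZeroAtInftyContinuousMap.norm_le_of_forall (by positivity) fun d => ?_
    rw [one_mul]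
    by_cases h : ∃ k, i k = d
    · obtain ⟨k, rfl⟩ := h
      simpa [hi.extend_apply] using f.norm_apply_le k
    · simp [Function.extend_apply' _ _ _ h]

/-- Restriction along an injection of discrete spaces. -/
noncomputable def restrictC0 (i : D → D') (hi : Function.Injective i) :
    C₀(D', 𝕜) →L[𝕜] C₀(D, 𝕜) :=
  LinearMap.mkContinuous
    { toFun := fun f => .ofCofinite (f ∘ i) (f.tendsto_cofinite.comp hi.tendsto_cofinite)
      map_add' := fun f g => by ext d; simp
      map_smul' := fun c f => by ext d; simp } 1 fun f => by
    refine ZeroAtInftyContinuousMap.norm_le_of_forall (by positivity) fun d => ?_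
    rw [one_mul]
    exact f.norm_apply_le _

theorem extendC0_apply (i : D → D') (hi : Function.Injective i) (f : C₀(D, 𝕜)) (d : D') :
    extendC0 i hi f d = Function.extend i f 0 d := rfl

theorem restrictC0_apply (i : D → D') (hi : Function.Injective i) (f : C₀(D', 𝕜)) (d : D) :
    restrictC0 i hi f d = f (i d) := rfl

theorem restrictC0_extendC0 (i : D → D') (hi : Function.Injective i) (f : C₀(D, 𝕜)) :
    restrictC0 i hi (extendC0 i hi f) = f := by
  ext d
  rw [restrictC0_apply, extendC0_apply, hi.extend_apply]

theorem restrictC0_extendC0_of_disjoint {D₁ : Type*} [TopologicalSpace D₁] [DiscreteTopology D₁]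
    (i : D → D') (hi : Function.Injective i) (k : D₁ → D') (hk : Function.Injective k)
    (h : ∀ a b, k a ≠ i b) (f : C₀(D₁, 𝕜)) : restrictC0 i hi (extendC0 k hk f) = 0 := by
  ext d
  rw [restrictC0_apply, extendC0_apply, Function.extend_apply' _ _ _ fun ⟨a, ha⟩ => h a d ha]
  rfl

-- The unit vectors span a dense subspace: `f` is within `ε / 2` of its truncation to the finite set
-- where `ε / 2 ≤ ‖f d‖`.
variable (𝕜) in
instance separableSpace_C0 [Countable D] : TopologicalSpace.SeparableSpace C₀(D, 𝕜) := by
  classical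
  have hs : ∀ d : D, Tendsto (Pi.single d (1 : 𝕜)) cofinite (𝓝 0) := by
    intro d
    rw [tendsto_cofinite_zero_iff]
    intro ε hε
    refine (Set.finite_singleton d).subset fun k hk => ?_
    by_contra hkd
    rw [Set.mem_ofPred_eq, Pi.single_eq_of_ne hkd, norm_zero] at hk
    linarith
  set e : D → C₀(D, 𝕜) := fun d => .ofCofinite _ (hs d) with he
  rw [← TopologicalSpace.isSeparable_univ_iff]
  refine ((Set.countable_range e).isSeparable.span (R := 𝕜)).closure.mono fun f _ => ?_
  rw [Metric.mem_closure_iff]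
  intro ε hε
  have hfin := tendsto_cofinite_zero_iff.1 f.tendsto_cofinite (ε / 2) (by positivity)
  refine ⟨∑ d ∈ hfin.toFinset, f d • e d,
    Submodule.sum_mem _ fun d _ => Submodule.smul_mem _ _ (Submodule.subset_span ⟨d, rfl⟩), ?_⟩
  rw [dist_eq_norm]
  refine (ZeroAtInftyContinuousMap.norm_le_of_forall (by positivity) fun k => ?_).trans_lt
    (half_lt_self hε)
  have hsum : (∑ d ∈ hfin.toFinset, f d • e d) k = if k ∈ hfin.toFinset then f k else 0 := by
    have : ∀ s : Finset D, (∑ d ∈ s, f d • e d) k = ∑ d ∈ s, f d • e d k := by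
      intro s
      induction s using Finset.induction_on with
      | empty => simp
      | insert a s ha ih =>
        rw [Finset.sum_insert ha, Finset.sum_insert ha, ZeroAtInftyContinuousMap.add_apply, ih]
        rfl
    rw [this]
    simp [he, Pi.single_apply]
  rw [ZeroAtInftyContinuousMap.sub_apply, hsum]
  split_ifs with h
  · simpa using (half_pos hε).le
  · rw [Set.Finite.mem_toFinset, Set.mem_ofPred_eq, not_le] at h
    simpa using h.le

end Discrete

end VanishingFunctions

/-! ### Consequences of the two properties -/

section SeparablyC0

variable (𝕜 : Type*) [RCLike 𝕜] (E : Type*) [NormedAddCommGroup E] [NormedSpace 𝕜 E]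

/-- `E` contains a complemented copy of `c₀`. -/
def HasComplementedC0 : Prop :=
  ∃ (J : C₀(ℕ, 𝕜) →L[𝕜] E) (P : E →L[𝕜] C₀(ℕ, 𝕜)), ∀ f, P (J f) = f

/-- Every separable subset of `E` lies in a subspace whose inclusion factors through `c₀`. -/
def SeparablyThroughC0 : Prop :=
  ∀ s : Set E, TopologicalSpace.IsSeparable s →
    ∃ (Y : Submodule 𝕜 E) (W : Y →L[𝕜] C₀(ℕ, 𝕜)) (V : C₀(ℕ, 𝕜) →L[𝕜] E),
      s ⊆ Y ∧ ∀ y : Y, V (W y) = y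

variable {𝕜 E}

/-- A sequence of operators with separable range factors through `c₀` with a common left
factor. -/
theorem SeparablyThroughC0.exists_factor (h : SeparablyThroughC0 𝕜 E) (T : ℕ → E →L[𝕜] E)
    (hT : ∀ j, T j ∈ separableRangeIdeal 𝕜 E) :
    ∃ (V : C₀(ℕ, 𝕜) →L[𝕜] E) (U : ℕ → E →L[𝕜] C₀(ℕ, 𝕜)) (K : ℝ),
      (∀ j, T j = V ∘L U j) ∧ ∀ j, ‖U j‖ ≤ K * ‖T j‖ := by
  -- One subspace for the union of all ranges makes the left factor `V` independent of `j`.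
  obtain ⟨Y, W, V, hY, hVW⟩ := h _ (TopologicalSpace.IsSeparable.iUnion hT)
  have hmem : ∀ j v, T j v ∈ Y := fun j v =>
    hY (Set.mem_iUnion.2 ⟨j, Set.mem_range_self v⟩)
  refine ⟨V, fun j => W ∘L (T j).codRestrict Y (hmem j), ‖W‖, fun j => ?_, fun j => ?_⟩
  · ext v
    exact (hVW ⟨T j v, hmem j v⟩).symm
  · refine (ContinuousLinearMap.opNorm_comp_le _ _).trans ?_
    refine mul_le_mul_of_nonneg_left ?_ (norm_nonneg W)
    exact ContinuousLinearMap.opNorm_le_bound _ (norm_nonneg _) fun v => (T j).le_opNorm v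

theorem Nat.pair_right_injective (j : ℕ) : Function.Injective (Nat.pair j) := by
  intro a b hab
  exact (Nat.pair_eq_pair.1 hab).2

variable (𝕜) in
/-- The `j`-th of a sequence of orthogonal projections on `c₀`, each with range isomorphic
to `c₀`. -/
noncomputable def rowProj (j : ℕ) : C₀(ℕ, 𝕜) →L[𝕜] C₀(ℕ, 𝕜) :=
  extendC0 (Nat.pair j) (Nat.pair_right_injective j) ∘L
    restrictC0 (Nat.pair j) (Nat.pair_right_injective j)

theorem rowProj_rowProj (j : ℕ) (f : C₀(ℕ, 𝕜)) : rowProj 𝕜 j (rowProj 𝕜 j f) = rowProj 𝕜 j f := by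
  simp only [rowProj, ContinuousLinearMap.comp_apply, restrictC0_extendC0]

theorem rowProj_rowProj_of_ne {j k : ℕ} (h : j ≠ k) (f : C₀(ℕ, 𝕜)) :
    rowProj 𝕜 j (rowProj 𝕜 k f) = 0 := by
  simp only [rowProj, ContinuousLinearMap.comp_apply]
  rw [restrictC0_extendC0_of_disjoint, map_zero]
  intro a b hab
  exact h (Nat.pair_eq_pair.1 hab).1.symm

theorem restrictC0_rowProj_extendC0 (j : ℕ) (f : C₀(ℕ, 𝕜)) :
    restrictC0 (Nat.pair j) (Nat.pair_right_injective j)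
      (rowProj 𝕜 j (extendC0 (Nat.pair j) (Nat.pair_right_injective j) f)) = f := by
  simp only [rowProj, ContinuousLinearMap.comp_apply, restrictC0_extendC0]

/-- Since `P J = id`, the operators `J (rowProj j) P` are orthogonal projections, and `T = V U` can
be routed through any row. Hence `n = 1` suffices, with `ι` and `π` identifying `E` with `Fin 1 →
E`. -/
theorem SeparablyThroughC0.isCompressible (h : SeparablyThroughC0 𝕜 E)
    (hc : HasComplementedC0 𝕜 E) (T : E →L[𝕜] E) (hT : T ∈ separableRangeIdeal 𝕜 E) :
    IsCompressible T := by
  obtain ⟨J, P, hPJ⟩ := hc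
  obtain ⟨V, U, -, hVU, -⟩ := h.exists_factor (fun _ => T) fun _ => hT
  let ι : E →L[𝕜] (Fin 1 → E) := ContinuousLinearMap.pi fun _ => ContinuousLinearMap.id 𝕜 E
  let π : (Fin 1 → E) →L[𝕜] E := ContinuousLinearMap.proj 0
  have hπι : ∀ v, π (ι v) = v := fun v => rfl
  refine ⟨1, le_rfl, fun j => ι ∘L J ∘L rowProj 𝕜 j ∘L P ∘L π, fun j => ?_, fun j k hjk => ?_,
    fun j => ⟨ι ∘L J ∘L extendC0 (Nat.pair j) (Nat.pair_right_injective j) ∘L U 0,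
      V ∘L restrictC0 (Nat.pair j) (Nat.pair_right_injective j) ∘L P ∘L π, ?_⟩⟩
  · refine ContinuousLinearMap.ext fun v => ?_
    simp only [ContinuousLinearMap.comp_apply, hπι, hPJ, rowProj_rowProj]
  · refine ContinuousLinearMap.ext fun v => ?_
    simp only [ContinuousLinearMap.comp_apply, hπι, hPJ, rowProj_rowProj_of_ne hjk, map_zero,
      zero_apply]
  · refine ContinuousLinearMap.ext fun v => ?_
    simp only [ContinuousLinearMap.comp_apply, hπι, hPJ, restrictC0_rowProj_extendC0]
    exact congrArg (fun S : E →L[𝕜] E => S v) (hVU 0)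

/-- Inserting `P J = id` in `T j = V U j` gives `(V P)(J U j)`. Both factors pass through the
separable space `c₀`, hence lie in the ideal. -/
theorem SeparablyThroughC0.exists_null_factor (h : SeparablyThroughC0 𝕜 E)
    (hc : HasComplementedC0 𝕜 E) (T : ℕ → separableRangeIdeal 𝕜 E)
    (hT : Tendsto (fun j => ‖T j‖) atTop (𝓝 0)) :
    ∃ (S : separableRangeIdeal 𝕜 E) (R : ℕ → separableRangeIdeal 𝕜 E),
      (∀ j, T j = S * R j) ∧ Tendsto (fun j => ‖R j‖) atTop (𝓝 0) := by
  obtain ⟨J, P, hPJ⟩ := hc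
  obtain ⟨V, U, K, hVU, hU⟩ := h.exists_factor (fun j => T j) fun j => (T j).2
  refine ⟨⟨V ∘L P, comp_mem_separableRangeIdeal V P⟩,
    fun j => ⟨J ∘L U j, comp_mem_separableRangeIdeal J (U j)⟩, fun j => ?_, ?_⟩
  · refine Subtype.ext (ContinuousLinearMap.ext fun v => ?_)
    refine (congrArg (fun S : E →L[𝕜] E => S v) (hVU j)).trans ?_
    exact congrArg V (hPJ (U j v)).symm
  · have h0 : Tendsto (fun j => ‖J‖ * (K * ‖T j‖)) atTop (𝓝 0) := by
      simpa using (hT.const_mul K).const_mul ‖J‖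
    refine squeeze_zero (fun j => norm_nonneg _) (fun j => ?_) h0
    exact (ContinuousLinearMap.opNorm_comp_le J (U j)).trans
      (mul_le_mul_of_nonneg_left (hU j) (norm_nonneg J))

theorem SeparablyThroughC0.continuous_hom [CompleteSpace E] (h : SeparablyThroughC0 𝕜 E)
    (hc : HasComplementedC0 𝕜 E) {C : Type*} [NonUnitalNormedRing C] [NormedSpace 𝕜 C]
    (θ : separableRangeIdeal 𝕜 E →ₙₐ[𝕜] C) : Continuous θ := by
  obtain ⟨J, P, hPJ⟩ := id hc
  let Q : ℕ → separableRangeIdeal 𝕜 E := fun j =>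
    ⟨J ∘L (rowProj 𝕜 j ∘L P), comp_mem_separableRangeIdeal _ _⟩
  obtain ⟨j, K, hK0, hK⟩ := exists_bound_map_idempotent_mul (𝕜 := 𝕜)
    (A := separableRangeIdeal 𝕜 E) θ Q
    (fun j => Subtype.ext <| ContinuousLinearMap.ext fun v => by
      change J (rowProj 𝕜 j (P (J (rowProj 𝕜 j (P v))))) = J (rowProj 𝕜 j (P v))
      rw [hPJ, rowProj_rowProj])
    (fun j k hjk => Subtype.ext <| ContinuousLinearMap.ext fun v => by
      change J (rowProj 𝕜 j (P (J (rowProj 𝕜 k (P v))))) = 0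
      rw [hPJ, rowProj_rowProj_of_ne hjk, map_zero])
  refine continuous_of_continuousAt_zero θ ?_
  refine tendsto_of_seq_tendsto fun T hT => ?_
  rw [map_zero]
  obtain ⟨S, R, hSR, hR⟩ := h.exists_null_factor hc T (tendsto_zero_iff_norm_tendsto_zero.1 hT)
  obtain ⟨V, U, -, hVU, -⟩ := h.exists_factor (fun _ => S) fun _ => S.2
  let r : separableRangeIdeal 𝕜 E :=
    ⟨J ∘L (extendC0 (Nat.pair j) (Nat.pair_right_injective j) ∘L U 0),
      comp_mem_separableRangeIdeal _ _⟩
  let s : separableRangeIdeal 𝕜 E :=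
    ⟨V ∘L (restrictC0 (Nat.pair j) (Nat.pair_right_injective j) ∘L P),
      comp_mem_separableRangeIdeal _ _⟩
  -- Routing the fixed factor `S` through row `j` brings the bound `hK` into play.
  have hS : S = s * (Q j * r) := Subtype.ext <| ContinuousLinearMap.ext fun v => by
    refine (congrArg (fun S : E →L[𝕜] E => S v) (hVU 0)).trans ?_
    change V (U 0 v) = V (restrictC0 (Nat.pair j) (Nat.pair_right_injective j)
      (P (J (rowProj 𝕜 j (P (J (extendC0 (Nat.pair j) (Nat.pair_right_injective j) (U 0 v))))))))
    rw [hPJ, hPJ, restrictC0_rowProj_extendC0]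
  have hθ : ∀ n, ‖θ (T n)‖ ≤ ‖θ s‖ * (K * (‖r‖ * ‖R n‖)) := by
    intro n
    rw [hSR, hS, mul_assoc, mul_assoc, map_mul]
    refine (norm_mul_le _ _).trans (mul_le_mul_of_nonneg_left ?_ (norm_nonneg _))
    exact (hK _).trans (mul_le_mul_of_nonneg_left (norm_mul_le _ _) hK0)
  have h0 : Tendsto (fun n => ‖θ s‖ * (K * (‖r‖ * ‖R n‖))) atTop (𝓝 0) := by
    simpa using ((hR.const_mul ‖r‖).const_mul K).const_mul ‖θ s‖
  exact squeeze_zero_norm hθ h0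

theorem SeparablyThroughC0.continuous_hom_of_finiteDimensional [CompleteSpace E]
    (h : SeparablyThroughC0 𝕜 E) (hc : HasComplementedC0 𝕜 E)
    [FiniteDimensional 𝕜 ((E →L[𝕜] E) ⧸ (separableRangeIdeal 𝕜 E).toSubmodule)]
    {C : Type*} [NonUnitalNormedRing C] [NormedSpace 𝕜 C]
    (θ : (E →L[𝕜] E) →ₙₐ[𝕜] C) : Continuous θ := by
  have hrestrict : Continuous fun T : separableRangeIdeal 𝕜 E => θ T :=
    h.continuous_hom hc
      (θ.comp (NonUnitalSubalgebraClass.subtype (separableRangeIdeal 𝕜 E)))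
  let f : (E →L[𝕜] E) →ₗ[𝕜] C :=
    { toFun := θ, map_add' := map_add θ, map_smul' := map_smul θ }
  exact LinearMap.continuous_of_continuous_restrict
    (separableRangeIdeal 𝕜 E).toSubmodule isClosed_separableRangeIdeal f hrestrict

/-- Operators through `c₀` lie in the ideal, so the class of the identity spans the quotient. -/
theorem finiteDimensional_quotient_of_factorsThroughC0
    (h : ∀ T : E →L[𝕜] E, ∃ (c : 𝕜) (S : E →L[𝕜] E),
      FactorsThroughC0 S ∧ T = c • ContinuousLinearMap.id 𝕜 E + S) :
    FiniteDimensional 𝕜 ((E →L[𝕜] E) ⧸ (separableRangeIdeal 𝕜 E).toSubmodule) := by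
  refine Module.Finite.of_surjective
    ((separableRangeIdeal 𝕜 E).toSubmodule.mkQ ∘ₗ
      LinearMap.toSpanSingleton 𝕜 (E →L[𝕜] E) (ContinuousLinearMap.id 𝕜 E)) ?_
  intro q
  obtain ⟨T, rfl⟩ := Submodule.mkQ_surjective _ q
  obtain ⟨c, S, ⟨U, V, rfl⟩, rfl⟩ := h T
  refine ⟨c, ?_⟩
  refine (Submodule.Quotient.eq _).2 ?_
  have hVU := comp_mem_separableRangeIdeal V U
  have : c • ContinuousLinearMap.id 𝕜 E - (c • ContinuousLinearMap.id 𝕜 E + V ∘L U)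
      = (-1 : 𝕜) • (V ∘L U) := by simp
  exact this ▸ (separableRangeIdeal 𝕜 E).toSubmodule.smul_mem _ hVU

end SeparablyC0

/-! ### Continuity and compactness in `K_𝒜` -/

namespace PsiSpace

variable {𝕜 : Type*} [RCLike 𝕜] {𝒜 : Set (Set ℕ)}

theorem y_injective : Function.Injective (y : 𝒜 → PsiSpace 𝒜) := fun _ _ h => by
  cases h
  rfl

theorem x_injective : Function.Injective (x : ℕ → PsiSpace 𝒜) := fun _ _ h => by
  cases h
  rfl

theorem nhds_x (n : ℕ) : 𝓝 (x n : PsiSpace 𝒜) = pure (x n) :=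
  (isOpen_singleton_iff_nhds_eq_pure _).1 (isOpen_singleton_x n)

theorem continuous_iff_finite {f : PsiSpace 𝒜 → 𝕜} :
    Continuous f ↔
      ∀ (A : 𝒜) (ε : ℝ), 0 < ε → {n ∈ (A : Set ℕ) | ε ≤ ‖f (x n) - f (y A)‖}.Finite := by
  rw [continuous_iff_continuousAt]
  constructor
  · intro h A ε hε
    obtain ⟨F, hF, hFε⟩ :=
      ((nhds_y_hasBasis A).tendsto_iff Metric.nhds_basis_ball).1 (h (y A)) ε hε
    refine hF.subset fun n hn => ?_
    by_contra hnF
    have := hFε (x n) (Or.inl ⟨n, ⟨hn.1, hnF⟩, rfl⟩)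
    rw [Metric.mem_ball, dist_eq_norm] at this
    exact absurd hn.2 (not_le.2 this)
  · rintro h (n | A)
    · rw [ContinuousAt, nhds_x]
      exact tendsto_pure_nhds f _
    · refine ((nhds_y_hasBasis A).tendsto_iff Metric.nhds_basis_ball).2 fun ε hε =>
        ⟨_, h A ε hε, ?_⟩
      rintro _ (⟨n, ⟨hnA, hn⟩, rfl⟩ | rfl)
      · rw [Metric.mem_ball, dist_eq_norm]
        by_contra hcon
        exact hn ⟨hnA, not_lt.1 hcon⟩
      · exact Metric.mem_ball_self hε

theorem isCompact_basicNhd (A : 𝒜) : IsCompact (basicNhd A ∅) := by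
  have h : Tendsto (fun n : (A : Set ℕ) => x (𝒜 := 𝒜) n) cofinite (𝓝 (y A)) := by
    rw [(nhds_y_hasBasis A).tendsto_right_iff]
    intro F hF
    rw [eventually_cofinite]
    refine (hF.preimage Subtype.val_injective.injOn).subset fun n hn => ?_
    by_contra hnF
    exact hn (Or.inl ⟨n, ⟨n.2, hnF⟩, rfl⟩)
  convert h.isCompact_insert_range_of_cofinite using 1
  ext p
  simp only [basicNhd, Set.sdiff_empty, Set.mem_insert_iff, Set.mem_range, Subtype.exists]
  constructor
  · rintro (⟨n, hn, rfl⟩ | rfl)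
    · exact Or.inr ⟨n, hn, rfl⟩
    · exact Or.inl rfl
  · rintro (rfl | ⟨n, hn, rfl⟩)
    · exact Or.inr rfl
    · exact Or.inl ⟨n, hn, rfl⟩

/-- Compact sets are, up to finitely many points, covered by the basic neighbourhoods of the
finitely many points `y A` in them. -/
theorem finite_of_isCompact {K : Set (PsiSpace 𝒜)} (hK : IsCompact K) :
    {A | y A ∈ K}.Finite ∧ {n | x n ∈ K ∧ ∀ A : 𝒜, y A ∈ K → n ∉ (A : Set ℕ)}.Finite := by
  classical
  -- A point `y A`, or a point `x n` with `n` in no `A` for which `y A ∈ K`, is covered only by its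
  -- own neighbourhood, so every finite subcover must keep it.
  let U : PsiSpace 𝒜 → Set (PsiSpace 𝒜) := fun p =>
    match p with
    | x n => {x n}
    | y A => basicNhd A ∅
  have hU : ∀ p ∈ K, U p ∈ 𝓝 p := by
    rintro (n | A) -
    · exact (isOpen_singleton_x n).mem_nhds rfl
    · exact (nhds_y_hasBasis A).mem_of_mem Set.finite_empty
  obtain ⟨t, htK, ht⟩ := hK.elim_nhds_subcover U hU
  constructor
  · refine (t.finite_toSet.preimage y_injective.injOn).subset fun A hA => ?_
    obtain ⟨p, hp, hpA⟩ := Set.mem_iUnion₂.1 (ht hA)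
    rcases p with n | B
    · cases hpA
    · rcases hpA with ⟨n, -, h⟩ | h
      · cases h
      · cases h
        exact hp
  · refine (t.finite_toSet.preimage x_injective.injOn).subset fun n hn => ?_
    obtain ⟨p, hp, hpn⟩ := Set.mem_iUnion₂.1 (ht hn.1)
    rcases p with m | B
    · cases hpn
      exact hp
    · rcases hpn with ⟨m, hm, h⟩ | h
      · cases h
        exact absurd hm.1 (hn.2 B (htK _ hp))
      · cases h

theorem isCompact_norm_ge (f : C₀(PsiSpace 𝒜, 𝕜)) {ε : ℝ} (hε : 0 < ε) :
    IsCompact {p | ε ≤ ‖f p‖} := by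
  have h := f.zero_at_infty'.eventually (Metric.ball_mem_nhds (0 : 𝕜) hε)
  obtain ⟨K, hK, hKf⟩ := mem_cocompact.1 h
  refine hK.of_isClosed_subset
    (isClosed_le continuous_const (continuous_norm.comp f.continuous)) fun p hp => ?_
  by_contra hpK
  have := hKf hpK
  exact absurd (show ε ≤ ‖f p‖ from hp) (not_le.2 (by simpa using! this))

theorem finite_norm_y_ge (f : C₀(PsiSpace 𝒜, 𝕜)) {ε : ℝ} (hε : 0 < ε) :
    {A | ε ≤ ‖f (y A)‖}.Finite :=
  (finite_of_isCompact (isCompact_norm_ge f hε)).1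

theorem finite_norm_x_ge (f : C₀(PsiSpace 𝒜, 𝕜)) {ε : ℝ} (hε : 0 < ε) :
    {n | ε ≤ ‖f (x n)‖ ∧ ∀ A : 𝒜, ε ≤ ‖f (y A)‖ → n ∉ (A : Set ℕ)}.Finite :=
  (finite_of_isCompact (isCompact_norm_ge f hε)).2

theorem finite_sub_ge (f : C₀(PsiSpace 𝒜, 𝕜)) (A : 𝒜) {ε : ℝ} (hε : 0 < ε) :
    {n ∈ (A : Set ℕ) | ε ≤ ‖f (x n) - f (y A)‖}.Finite :=
  continuous_iff_finite.1 f.continuous A ε hε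

/-- Finitely many compact sets `basicNhd A ∅` and finitely many `x n` contain every point where `ε ≤
‖f p‖`. -/
theorem tendsto_cocompact_zero {f : PsiSpace 𝒜 → 𝕜}
    (h : ∀ ε > 0, ∃ s : Set 𝒜, s.Finite ∧ (∀ A ∉ s, ‖f (y A)‖ < ε) ∧
      {n | ε ≤ ‖f (x n)‖ ∧ ∀ A ∈ s, n ∉ (A : Set ℕ)}.Finite) :
    Tendsto f (cocompact _) (𝓝 0) := by
  rw [Metric.tendsto_nhds]
  intro ε hε
  obtain ⟨s, hs, hsy, hsx⟩ := h ε hε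
  refine mem_cocompact.2 ⟨(⋃ A ∈ s, basicNhd A ∅) ∪ x '' _,
    (hs.isCompact_biUnion fun A _ => isCompact_basicNhd A).union (hsx.image x).isCompact, ?_⟩
  intro p hp
  rw [Set.mem_ofPred_eq, dist_zero_right]
  by_contra hcon
  rw [not_lt] at hcon
  refine hp ?_
  rcases p with n | A
  · by_cases hn : ∀ A ∈ s, n ∉ (A : Set ℕ)
    · exact Or.inr ⟨n, ⟨hcon, hn⟩, rfl⟩
    · push Not at hn
      obtain ⟨A, hA, hnA⟩ := hn
      exact Or.inl (Set.mem_iUnion₂.2 ⟨A, hA, Or.inl ⟨n, ⟨hnA, fun h => h⟩, rfl⟩⟩)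
  · have hA : A ∈ s := by
      by_contra hA
      exact absurd hcon (not_le.2 (hsy A hA))
    exact Or.inl (Set.mem_iUnion₂.2 ⟨A, hA, Or.inr rfl⟩)

/-- Evaluation at a point, as a bounded functional on `C₀(K_𝒜)`. -/
noncomputable def evalC0 (𝕜 : Type*) [RCLike 𝕜] (p : PsiSpace 𝒜) : C₀(PsiSpace 𝒜, 𝕜) →L[𝕜] 𝕜 :=
  LinearMap.mkContinuous
    { toFun := fun f => f p
      map_add' := fun _ _ => rfl
      map_smul' := fun _ _ => rfl } 1 fun f => by
    rw [one_mul]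
    exact f.norm_apply_le p

/-! ### A complemented copy of `c₀` -/

section ComplementedCopy

/-- The function on `K_𝒜` with the values `g n` at `x n` and `0` at `y A`. -/
def ofSeq (g : ℕ → 𝕜) : PsiSpace 𝒜 → 𝕜
  | x n => g n
  | y _ => 0

/-- The embedding of `c₀` in `C₀(K_𝒜)` as the functions that vanish at all the points `y A`. -/
noncomputable def seqEmbedding (𝕜 : Type*) [RCLike 𝕜] (𝒜 : Set (Set ℕ)) :
    C₀(ℕ, 𝕜) →L[𝕜] C₀(PsiSpace 𝒜, 𝕜) :=
  LinearMap.mkContinuous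
    { toFun := fun g =>
        ⟨⟨ofSeq g, continuous_iff_finite.2 fun A ε hε => by
            refine (tendsto_cofinite_zero_iff.1 g.tendsto_cofinite ε hε).subset fun n hn => ?_
            simpa [ofSeq] using hn.2⟩,
          tendsto_cocompact_zero fun ε hε => ⟨∅, Set.finite_empty, fun A _ => by
            simpa [ofSeq] using hε, by
            refine (tendsto_cofinite_zero_iff.1 g.tendsto_cofinite ε hε).subset fun n hn => ?_
            exact hn.1⟩⟩
      map_add' := fun f g => by
        ext (n | A)
        · rfl
        · exact (add_zero 0).symm
      map_smul' := fun c g => by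
        ext (n | A)
        · rfl
        · exact (smul_zero c).symm } 1 fun g => by
    refine ZeroAtInftyContinuousMap.norm_le_of_forall (by positivity) ?_
    rw [one_mul]
    rintro (n | A)
    · exact g.norm_apply_le n
    · change ‖(0 : 𝕜)‖ ≤ _
      simp

theorem seqEmbedding_x (g : C₀(ℕ, 𝕜)) (n : ℕ) : seqEmbedding 𝕜 𝒜 g (x n) = g n := rfl

theorem seqEmbedding_y (g : C₀(ℕ, 𝕜)) (A : 𝒜) : seqEmbedding 𝕜 𝒜 g (y A) = 0 := rfl

/-- A sequence of points `x (e k)` and a functional that gives the limits along it yield a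
complemented copy of `c₀`. -/
theorem hasComplementedC0_of_limit (e : ℕ → ℕ) (he : Function.Injective e)
    (φ : C₀(PsiSpace 𝒜, 𝕜) →L[𝕜] 𝕜)
    (hφ : ∀ f, Tendsto (fun k => f (x (e k)) - φ f) cofinite (𝓝 0))
    (hφ0 : ∀ g, φ (seqEmbedding 𝕜 𝒜 g) = 0) :
    HasComplementedC0 𝕜 C₀(PsiSpace 𝒜, 𝕜) := by
  let P : C₀(PsiSpace 𝒜, 𝕜) →L[𝕜] C₀(ℕ, 𝕜) := LinearMap.mkContinuous
    { toFun := fun f => .ofCofinite _ (hφ f)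
      map_add' := fun f g => by
        ext k
        simp only [ZeroAtInftyContinuousMap.ofCofinite_apply, map_add,
          ZeroAtInftyContinuousMap.add_apply]
        ring
      map_smul' := fun c f => by
        ext k
        simp [mul_sub] } (1 + ‖φ‖) fun f => by
    refine ZeroAtInftyContinuousMap.norm_le_of_forall (by positivity) fun k => ?_
    refine (norm_sub_le _ _).trans ?_
    rw [add_mul, one_mul]
    exact add_le_add (f.norm_apply_le _) (φ.le_opNorm f)
  refine ⟨seqEmbedding 𝕜 𝒜 ∘L extendC0 e he, P, fun f => ?_⟩
  ext k
  change seqEmbedding 𝕜 𝒜 (extendC0 e he f) (x (e k)) - φ (seqEmbedding 𝕜 𝒜 _) = _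
  rw [hφ0, sub_zero, seqEmbedding_x, extendC0_apply, he.extend_apply]

/-- For `A ∈ 𝒜` the values `f (x n)` along `A` tend to `f (y A)`. If `𝒜` is empty, `f (x n)` tends
to zero along `ℕ`. -/
theorem hasComplementedC0 (h𝒜 : IsAlmostDisjointFamily 𝒜) :
    HasComplementedC0 𝕜 C₀(PsiSpace 𝒜, 𝕜) := by
  rcases isEmpty_or_nonempty 𝒜 with h | ⟨⟨A⟩⟩
  · refine hasComplementedC0_of_limit id Function.injective_id 0 (fun f => ?_) fun _ => rfl
    refine tendsto_cofinite_zero_iff.2 fun ε hε => ?_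
    refine (finite_norm_x_ge f hε).subset fun n hn => ⟨?_, fun A => (h.false A).elim⟩
    simpa using hn
  · let e := (h𝒜.1 A A.2).natEmbedding
    refine hasComplementedC0_of_limit (fun k => e k)
      (Subtype.val_injective.comp e.injective) (evalC0 𝕜 (y A)) (fun f => ?_)
      fun g => seqEmbedding_y g A
    refine tendsto_cofinite_zero_iff.2 fun ε hε => ?_
    refine ((finite_sub_ge f A hε).preimage
      (Subtype.val_injective.comp e.injective).injOn).subset fun k hk => ⟨(e k).2, hk⟩

end ComplementedCopy

/-! ### `c₀`-coordinates over a countable subfamily -/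

section CountableSubfamily

variable {ι : Type*} {s : ι → 𝒜} {r : ℕ → Option ι}

/-- `r` assigns each `n` to at most one of the sets `s i` to which it belongs, and the set of the
`n` assigned to `s i` differs from `s i` by a finite set. -/
structure IsAssignment (s : ι → 𝒜) (r : ℕ → Option ι) : Prop where
  mem : ∀ n i, r n = some i → n ∈ (s i : Set ℕ)
  finite : ∀ i, {n ∈ (s i : Set ℕ) | r n ≠ some i}.Finite

/-- Enumerate `ι` and assign `n` to the first set containing it. The members of `s i` assigned
elsewhere lie in the finite sets `s i ∩ s j` for the finitely many earlier `j`. -/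
theorem exists_isAssignment [Countable ι] (h𝒜 : IsAlmostDisjointFamily 𝒜)
    (hs : Function.Injective s) : ∃ r, IsAssignment s r := by
  classical
  obtain ⟨c, hc⟩ := exists_injective_nat ι
  have hex : ∀ n, ∃ o : Option ι, (∀ i, o = some i → n ∈ (s i : Set ℕ)) ∧
      ∀ i, n ∈ (s i : Set ℕ) → ∃ j, o = some j ∧ c j ≤ c i := by
    intro n
    by_cases hn : {i | n ∈ (s i : Set ℕ)}.Nonempty
    · refine ⟨some (Function.argminOn c _ hn), fun i hi => ?_, fun i hi => ⟨_, rfl, ?_⟩⟩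
      · cases hi
        exact Function.argminOn_mem c _ hn
      · exact Function.argminOn_le c _ hi
    · exact ⟨none, fun i hi => by simp at hi, fun i hi => (hn ⟨i, hi⟩).elim⟩
  choose r hr1 hr2 using hex
  refine ⟨r, ⟨hr1, fun i => ?_⟩⟩
  have hfin : {j | c j < c i}.Finite := (Set.finite_Iio (c i)).preimage hc.injOn
  refine (hfin.biUnion (t := fun j => (s i : Set ℕ) ∩ s j) fun j hj => ?_).subset ?_
  · refine h𝒜.2 _ (s i).2 _ (s j).2 fun h => ?_
    have : i = j := hs (Subtype.ext h)
    subst this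
    exact lt_irrefl _ (show c i < c i from hj)
  · rintro n ⟨hn, hne⟩
    obtain ⟨j, hj, hji⟩ := hr2 n i hn
    refine Set.mem_iUnion₂.2 ⟨j, ?_, hn, hr1 n j hj⟩
    refine lt_of_le_of_ne hji fun h => hne ?_
    rw [hj, hc h]

variable (𝕜) in
/-- The functions that vanish at `y A` unless `A` is one of the sets `s i`. -/
def supportedOn (s : ι → 𝒜) : Submodule 𝕜 C₀(PsiSpace 𝒜, 𝕜) where
  carrier := {f | ∀ A ∉ Set.range s, f (y A) = 0}
  zero_mem' := fun _ _ => rfl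
  add_mem' := fun hf hg A hA => by
    rw [ZeroAtInftyContinuousMap.add_apply, hf A hA, hg A hA, add_zero]
  smul_mem' := fun c f hf A hA => by
    rw [ZeroAtInftyContinuousMap.smul_apply, hf A hA, smul_zero]

/-- The coordinates of a function on `K_𝒜`: the values at the points `y (s i)`, and the
differences between the values at `x n` and at `y (s i)` for `n` assigned to `s i`. -/
def coord (s : ι → 𝒜) (r : ℕ → Option ι) (f : PsiSpace 𝒜 → 𝕜) : ι ⊕ ℕ → 𝕜 :=
  Sum.elim (fun i => f (y (s i))) fun n => f (x n) - (r n).elim 0 fun i => f (y (s i))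

/-- If the coordinate at `n` is at least `ε`, then, up to finitely many `n`, `n` lies in one of the
finitely many `s i` with `ε / 2 ≤ ‖f (y (s i))‖`. In each of these only finitely many `n` are
assigned elsewhere or have `f (x n)` at distance at least `ε` from `f (y (s i))`. -/
theorem tendsto_coord (hs : Function.Injective s) (hr : IsAssignment s r)
    {f : C₀(PsiSpace 𝒜, 𝕜)} (hf : f ∈ supportedOn 𝕜 s) :
    Tendsto (coord s r f) cofinite (𝓝 0) := by
  refine tendsto_cofinite_zero_iff.2 fun ε hε => ?_
  have hδ : 0 < ε / 2 := half_pos hε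
  have hI : ∀ {δ : ℝ}, 0 < δ → {i | δ ≤ ‖f (y (s i))‖}.Finite := fun hδ =>
    Set.Finite.preimage (f := s) hs.injOn (finite_norm_y_ge f hδ)
  have hN : {n | ε ≤ ‖coord s r f (Sum.inr n)‖}.Finite := by
    refine ((finite_norm_x_ge f hδ).union ((hI hδ).biUnion fun i _ =>
      (hr.finite i).union (finite_sub_ge f (s i) hε))).subset fun n hn => ?_
    change ε ≤ ‖f (x n) - (r n).elim 0 fun i => f (y (s i))‖ at hn
    have key : ∀ i, n ∈ (s i : Set ℕ) → ε / 2 ≤ ‖f (y (s i))‖ →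
        n ∈ ⋃ i ∈ {i | ε / 2 ≤ ‖f (y (s i))‖}, ({n ∈ (s i : Set ℕ) | r n ≠ some i} ∪
          {n ∈ (s i : Set ℕ) | ε ≤ ‖f (x n) - f (y (s i))‖}) := by
      intro i hni hi
      refine Set.mem_iUnion₂.2 ⟨i, hi, ?_⟩
      by_cases hri : r n = some i
      · rw [hri] at hn
        exact Or.inr ⟨hni, hn⟩
      · exact Or.inl ⟨hni, hri⟩
    by_cases hfx : ε / 2 ≤ ‖f (x n)‖
    · by_cases hA : ∀ A : 𝒜, ε / 2 ≤ ‖f (y A)‖ → n ∉ (A : Set ℕ)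
      · exact Or.inl ⟨hfx, hA⟩
      · push Not at hA
        obtain ⟨A, hA, hnA⟩ := hA
        have hAs : A ∈ Set.range s := by
          by_contra hAs
          rw [hf A hAs, norm_zero] at hA
          linarith
        obtain ⟨i, rfl⟩ := hAs
        exact Or.inr (key i hnA hA)
    · rw [not_le] at hfx
      refine Or.inr ?_
      have h2 := hn.trans (norm_sub_le _ _)
      rcases hrn : r n with _ | i
      · rw [hrn] at h2
        simp only [Option.elim_none, norm_zero, add_zero] at h2
        linarith
      · rw [hrn] at h2
        simp only [Option.elim_some] at h2
        exact key i (hr.mem n i hrn) (by linarith)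
  refine (((hI hε).image Sum.inl).union (hN.image Sum.inr)).subset ?_
  rintro (i | n) hd
  · exact Or.inl ⟨i, hd, rfl⟩
  · exact Or.inr ⟨n, hd, rfl⟩

/-- The function on `K_𝒜` with given coordinates. -/
noncomputable def ofCoord (s : ι → 𝒜) (r : ℕ → Option ι) (g : ι ⊕ ℕ → 𝕜) : PsiSpace 𝒜 → 𝕜
  | x n => g (Sum.inr n) + (r n).elim 0 fun i => g (Sum.inl i)
  | y A => Function.extend s (fun i => g (Sum.inl i)) 0 A

theorem finite_inl_ge {g : ι ⊕ ℕ → 𝕜} (hg : Tendsto g cofinite (𝓝 0)) {ε : ℝ} (hε : 0 < ε) :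
    {i | ε ≤ ‖g (Sum.inl i)‖}.Finite :=
  Set.Finite.preimage (f := Sum.inl) Sum.inl_injective.injOn (tendsto_cofinite_zero_iff.1 hg ε hε)

theorem finite_inr_ge {g : ι ⊕ ℕ → 𝕜} (hg : Tendsto g cofinite (𝓝 0)) {ε : ℝ} (hε : 0 < ε) :
    {n | ε ≤ ‖g (Sum.inr n)‖}.Finite :=
  Set.Finite.preimage (f := Sum.inr) Sum.inr_injective.injOn (tendsto_cofinite_zero_iff.1 hg ε hε)

theorem norm_ge_half_of_ofCoord_x {g : ι ⊕ ℕ → 𝕜} {n : ℕ} {ε : ℝ} (hε : 0 < ε)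
    (h : ε ≤ ‖ofCoord s r g (x n)‖) :
    ε / 2 ≤ ‖g (Sum.inr n)‖ ∨ ∃ i, r n = some i ∧ ε / 2 ≤ ‖g (Sum.inl i)‖ := by
  by_contra! hcon
  have h2 : ‖(r n).elim 0 fun i => g (Sum.inl i)‖ < ε / 2 := by
    rcases hrn : r n with _ | i
    · simpa using hε
    · exact hcon.2 i hrn
  have h3 := norm_add_le (g (Sum.inr n)) ((r n).elim 0 fun i => g (Sum.inl i))
  have h4 : ε ≤ ‖g (Sum.inr n) + (r n).elim 0 fun i => g (Sum.inl i)‖ := h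
  linarith [hcon.1]

/-- At `y (s i)` the deviation is `g (Sum.inr n)` for all but finitely many `n` in `s i`. At any
other `y A` the value is zero, and the large `g (Sum.inl i)` contribute only on finitely many finite
sets `s i ∩ A`. -/
theorem continuous_ofCoord (h𝒜 : IsAlmostDisjointFamily 𝒜) (hs : Function.Injective s)
    (hr : IsAssignment s r) {g : ι ⊕ ℕ → 𝕜} (hg : Tendsto g cofinite (𝓝 0)) :
    Continuous (ofCoord s r g) := by
  refine continuous_iff_finite.2 fun A ε hε => ?_
  by_cases hA : ∃ i, s i = A
  · obtain ⟨i, rfl⟩ := hA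
    refine ((hr.finite i).union (finite_inr_ge hg hε)).subset ?_
    rintro n ⟨hn, hnε⟩
    by_cases hri : r n = some i
    · right
      simpa [ofCoord, hri, hs.extend_apply] using hnε
    · exact Or.inl ⟨hn, hri⟩
  · refine ((finite_inr_ge hg (half_pos hε)).union
      ((finite_inl_ge hg (half_pos hε)).biUnion (t := fun i => (s i : Set ℕ) ∩ A)
        fun i _ => ?_)).subset ?_
    · exact h𝒜.2 _ (s i).2 _ A.2 fun h => hA ⟨i, Subtype.ext h⟩
    · rintro n ⟨hn, hnε⟩
      have h0 : ofCoord s r g (y A) = 0 := by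
        rw [ofCoord, Function.extend_apply' _ _ _ hA, Pi.zero_apply]
      rw [h0, sub_zero] at hnε
      rcases norm_ge_half_of_ofCoord_x hε hnε with h | ⟨i, hi, h⟩
      · exact Or.inl h
      · exact Or.inr (Set.mem_iUnion₂.2 ⟨i, h, hr.mem n i hi, hn⟩)

theorem tendsto_ofCoord (hs : Function.Injective s) (hr : IsAssignment s r)
    {g : ι ⊕ ℕ → 𝕜} (hg : Tendsto g cofinite (𝓝 0)) :
    Tendsto (ofCoord s r g) (cocompact _) (𝓝 0) := by
  refine tendsto_cocompact_zero fun ε hε => ⟨s '' {i | ε / 2 ≤ ‖g (Sum.inl i)‖},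
    (finite_inl_ge hg (half_pos hε)).image s, fun A hA => ?_,
    (finite_inr_ge hg (half_pos hε)).subset ?_⟩
  · by_cases hAs : ∃ i, s i = A
    · obtain ⟨i, rfl⟩ := hAs
      by_contra! hcon
      rw [ofCoord, hs.extend_apply] at hcon
      exact hA ⟨i, (half_le_self hε.le).trans hcon, rfl⟩
    · rw [ofCoord, Function.extend_apply' _ _ _ hAs]
      simpa using hε
  · rintro n ⟨hn, hnA⟩
    rcases norm_ge_half_of_ofCoord_x hε hn with h | ⟨i, hi, h⟩
    · exact h
    · exact absurd (hr.mem n i hi) (hnA _ ⟨i, h, rfl⟩)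

variable [TopologicalSpace ι] [DiscreteTopology ι]

/-- The coordinates, as a bounded operator with values in `c₀`. -/
noncomputable def coordCLM (hs : Function.Injective s) (hr : IsAssignment s r) :
    supportedOn 𝕜 s →L[𝕜] C₀(ι ⊕ ℕ, 𝕜) :=
  LinearMap.mkContinuous
    { toFun := fun f : supportedOn 𝕜 s =>
        .ofCofinite (coord s r (f : C₀(PsiSpace 𝒜, 𝕜))) (tendsto_coord hs hr f.2)
      map_add' := fun f g => by
        ext (i | n)
        · rfl
        · rcases hrn : r n with _ | i
          · simp [coord, hrn]
          · simp [coord, hrn]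
            ring
      map_smul' := fun c f => by
        ext (i | n)
        · rfl
        · rcases hrn : r n with _ | i
          · simp [coord, hrn]
          · simp [coord, hrn, mul_sub] } 2 fun f => by
    have hp : ∀ p, ‖(f : C₀(PsiSpace 𝒜, 𝕜)) p‖ ≤ ‖f‖ := fun p =>
      (f : C₀(PsiSpace 𝒜, 𝕜)).norm_apply_le p
    have h0 := norm_nonneg f
    refine ZeroAtInftyContinuousMap.norm_le_of_forall (by positivity) ?_
    rintro (i | n)
    · exact (hp (y (s i))).trans (by linarith)
    · refine (norm_sub_le _ _).trans ?_
      rw [two_mul]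
      refine add_le_add (hp _) ?_
      rcases r n with _ | i
      · simp
      · exact hp _

/-- The reconstruction of a function from its coordinates, as a bounded operator. -/
noncomputable def ofCoordCLM (h𝒜 : IsAlmostDisjointFamily 𝒜) (hs : Function.Injective s)
    (hr : IsAssignment s r) : C₀(ι ⊕ ℕ, 𝕜) →L[𝕜] C₀(PsiSpace 𝒜, 𝕜) :=
  LinearMap.mkContinuous
    { toFun := fun g => ⟨⟨ofCoord s r g, continuous_ofCoord h𝒜 hs hr g.tendsto_cofinite⟩,
        tendsto_ofCoord hs hr g.tendsto_cofinite⟩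
      map_add' := fun f g => by
        ext (n | A)
        · rcases hrn : r n with _ | i
          · simp [ofCoord, hrn]
          · simp [ofCoord, hrn]
            ring
        · by_cases hA : ∃ i, s i = A
          · obtain ⟨i, rfl⟩ := hA
            simp [ofCoord, hs.extend_apply]
          · simp [ofCoord, Function.extend_apply' _ _ _ hA]
      map_smul' := fun c g => by
        ext (n | A)
        · rcases hrn : r n with _ | i
          · simp [ofCoord, hrn]
          · simp [ofCoord, hrn, mul_add]
        · by_cases hA : ∃ i, s i = A
          · obtain ⟨i, rfl⟩ := hA
            simp [ofCoord, hs.extend_apply]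
          · simp [ofCoord, Function.extend_apply' _ _ _ hA] } 2 fun g => by
    have h0 := norm_nonneg g
    refine ZeroAtInftyContinuousMap.norm_le_of_forall (by positivity) ?_
    rintro (n | A)
    · refine (norm_add_le _ _).trans ?_
      rw [two_mul]
      refine add_le_add (g.norm_apply_le _) ?_
      rcases r n with _ | i
      · simp
      · exact g.norm_apply_le _
    · by_cases hA : ∃ i, s i = A
      · obtain ⟨i, rfl⟩ := hA
        simpa [ofCoord, hs.extend_apply] using (g.norm_apply_le (Sum.inl i)).trans (by linarith)
      · simp [ofCoord, Function.extend_apply' _ _ _ hA]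

theorem ofCoordCLM_coordCLM (h𝒜 : IsAlmostDisjointFamily 𝒜) (hs : Function.Injective s)
    (hr : IsAssignment s r) (f : supportedOn 𝕜 s) :
    ofCoordCLM h𝒜 hs hr (coordCLM hs hr f) = f := by
  ext p
  change ofCoord s r (coord s r (f : C₀(PsiSpace 𝒜, 𝕜))) p = _
  rcases p with n | A
  · exact sub_add_cancel _ _
  · by_cases hA : ∃ i, s i = A
    · obtain ⟨i, rfl⟩ := hA
      simp [ofCoord, coord, hs.extend_apply]
    · rw [ofCoord, Function.extend_apply' _ _ _ hA]
      exact (f.2 A hA).symm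

end CountableSubfamily

theorem countable_support_y (f : C₀(PsiSpace 𝒜, 𝕜)) : {A | f (y A) ≠ 0}.Countable := by
  refine (Set.countable_iUnion fun n : ℕ =>
    (finite_norm_y_ge f (Nat.one_div_pos_of_nat (α := ℝ) (n := n))).countable).mono ?_
  intro A hA
  obtain ⟨n, hn⟩ := exists_nat_one_div_lt (norm_pos_iff.2 hA)
  exact Set.mem_iUnion.2 ⟨n, hn.le⟩

/-- Over a countable set `c` whose closure contains `t`, only countably many `y A` matter; vanishing
at the others is a closed condition, so it passes from `c` to `t`. -/
theorem separablyThroughC0 (h𝒜 : IsAlmostDisjointFamily 𝒜) :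
    SeparablyThroughC0 𝕜 C₀(PsiSpace 𝒜, 𝕜) := by
  rintro t ⟨c, hc, htc⟩
  let ℬ : Set 𝒜 := ⋃ f ∈ c, {A | f (y A) ≠ 0}
  have hℬ : ℬ.Countable := hc.biUnion fun f _ => countable_support_y f
  have : Countable ℬ := hℬ.to_subtype
  -- With the discrete topology, `C₀(ℬ ⊕ ℕ, 𝕜)` is `c₀` of a countable set, which embeds in `c₀`
  -- through the injection `i`.
  let _ : TopologicalSpace ℬ := ⊥
  have : DiscreteTopology ℬ := ⟨rfl⟩
  have hs : Function.Injective (Subtype.val : ℬ → 𝒜) := Subtype.val_injective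
  obtain ⟨r, hr⟩ := exists_isAssignment h𝒜 hs
  obtain ⟨i, hi⟩ := exists_injective_nat (ℬ ⊕ ℕ)
  refine ⟨supportedOn 𝕜 Subtype.val, extendC0 i hi ∘L coordCLM hs hr,
    ofCoordCLM h𝒜 hs hr ∘L restrictC0 i hi, fun f hf A hA => ?_, fun f => ?_⟩
  · rw [Subtype.range_coe] at hA
    have hclosed : IsClosed {f | evalC0 𝕜 (y A) f = 0} :=
      isClosed_eq (evalC0 𝕜 (y A)).continuous continuous_const
    refine closure_minimal (fun g hg => ?_) hclosed (htc hf)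
    by_contra hne
    exact hA (Set.mem_iUnion₂.2 ⟨g, hg, hne⟩)
  · simp only [ContinuousLinearMap.comp_apply, restrictC0_extendC0]
    exact ofCoordCLM_coordCLM h𝒜 hs hr f

end PsiSpace

theorem corollary5p4 {𝕜 : Type*} [RCLike 𝕜] (𝒜 : Set (Set ℕ))
    (h𝒜 : IsAlmostDisjointFamily 𝒜) :
    -- every operator with separable range is compressible
    (∀ T ∈ separableRangeIdeal 𝕜 C₀(PsiSpace 𝒜, 𝕜), IsCompressible T) ∧
    -- null sequences of operators with separable range factor
    (∀ T : ℕ → separableRangeIdeal 𝕜 C₀(PsiSpace 𝒜, 𝕜),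
      Tendsto (fun j => ‖T j‖) atTop (𝓝 0) →
      ∃ (S : separableRangeIdeal 𝕜 C₀(PsiSpace 𝒜, 𝕜))
        (R : ℕ → separableRangeIdeal 𝕜 C₀(PsiSpace 𝒜, 𝕜)),
        (∀ j, T j = S * R j) ∧ Tendsto (fun j => ‖R j‖) atTop (𝓝 0)) ∧
    -- homomorphisms from the ideal into Banach algebras are continuous
    (∀ (C : Type*) [NonUnitalNormedRing C] [NormedSpace 𝕜 C] [IsScalarTower 𝕜 C C]
      [SMulCommClass 𝕜 C C] [CompleteSpace C]
      (θ : separableRangeIdeal 𝕜 C₀(PsiSpace 𝒜, 𝕜) →ₙₐ[𝕜] C), Continuous θ) ∧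
    -- if the ideal has finite codimension, so are those from the algebra of all operators
    (FiniteDimensional 𝕜 ((C₀(PsiSpace 𝒜, 𝕜) →L[𝕜] C₀(PsiSpace 𝒜, 𝕜)) ⧸
        (separableRangeIdeal 𝕜 C₀(PsiSpace 𝒜, 𝕜)).toSubmodule) →
      ∀ (C : Type*) [NonUnitalNormedRing C] [NormedSpace 𝕜 C] [IsScalarTower 𝕜 C C]
        [SMulCommClass 𝕜 C C] [CompleteSpace C]
        (θ : (C₀(PsiSpace 𝒜, 𝕜) →L[𝕜] C₀(PsiSpace 𝒜, 𝕜)) →ₙₐ[𝕜] C), Continuous θ) ∧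
    -- finite codimension holds as soon as every operator is `λ Id + S` with `S` factoring
    -- through `c₀`
    ((∀ T : C₀(PsiSpace 𝒜, 𝕜) →L[𝕜] C₀(PsiSpace 𝒜, 𝕜),
        ∃ (c : 𝕜) (S : C₀(PsiSpace 𝒜, 𝕜) →L[𝕜] C₀(PsiSpace 𝒜, 𝕜)),
          FactorsThroughC0 S ∧ T = c • ContinuousLinearMap.id 𝕜 C₀(PsiSpace 𝒜, 𝕜) + S) →
      FiniteDimensional 𝕜 ((C₀(PsiSpace 𝒜, 𝕜) →L[𝕜] C₀(PsiSpace 𝒜, 𝕜)) ⧸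
        (separableRangeIdeal 𝕜 C₀(PsiSpace 𝒜, 𝕜)).toSubmodule)) := by
  have hsep := PsiSpace.separablyThroughC0 (𝕜 := 𝕜) h𝒜
  have hcomp := PsiSpace.hasComplementedC0 (𝕜 := 𝕜) h𝒜
  exact ⟨hsep.isCompressible hcomp, hsep.exists_null_factor hcomp,
    fun C _ _ _ _ _ θ => hsep.continuous_hom hcomp θ,
    fun _ C _ _ _ _ _ θ => hsep.continuous_hom_of_finiteDimensional hcomp θ,
    finiteDimensional_quotient_of_factorsThroughC0⟩
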